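/- Let $\Lambda_\oplus$ be the set of probabilistic $\lambda$-terms $M,N ::= x \mid \lambda x.M \mid MN \mid M\oplus N$, modulo renaming of bound variables, over a countably infinite set of variables. Head normal forms (hnfs) are the terms $\lambda x_1\ldots x_n.\,yN_1\ldots N_m$; they are neutral if $n=0$. A head distribution is a subprobability distribution on hnfs, and $\lambda x.\mathscr D$ is the distribution with $(\lambda x.\mathscr D)(\lambda x.H)=\mathscr D(H)$ which vanishes on all other hnfs. The relation $M\Downarrow\mathscr D$ between terms and head distributions is generated inductively by the following rules, in which an hnf also stands for the distribution concentrated on it: * $M\Downarrow\bot$, where $\bot$ is the zero distribution; * $x\Downarrow x$; * if $M\Downarrow\mathscr D$, then $\lambda x.M\Downarrow\lambda x.\mathscr D$; * if $M\Downarrow\mathscr D$ and $H[N/x]\Downarrow\mathscr E_{H}$ for each $\lambda x.H\in\mathrm{supp}(\mathscr D)$, then $MN\Downarrow\sum_{\lambda x.H\in\mathrm{supp}(\mathscr D)}\mathscr D(\lambda x.H)\cdot\mathscr E_{H}+\sum_{H\in\mathrm{supp}(\mathscr D)\text{ neutral}}\mathscr D(H)\cdot HN$; * if $M\Downarrow\mathscr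 D$ and $N\Downarrow\mathscr E$, then $M\oplus N\Downarrow\frac12\mathscr D+\frac12\mathscr E$. Let $[\![M]\!]=\sup\{\mathscr D\mid M\Downarrow\mathscr D\}$ (a directed, pointwise supremum), and write $\sum[\![M]\!]$ for its total mass. The contextual preorder is defined by: $M\le_{\mathrm{cxt}}N$ iff $\sum[\![\mathcal C[M]]\!]\le\sum[\![\mathcal C[N]]\!]$ for every one-hole context $\mathcal C$ (filling the hole may capture variables). Consider the labelled Markov chain whose states are the closed terms together with a disjoint copy $\nu x.H$ of each closed hnf $\lambda x.H$, whose labels are $\tau$ and the closed terms, and whose only possibly nonzero transition probabilities are $\mathcal P(M,\tau,\nu x.H)=[\![M]\!](\lambda x.H)$ and $\mathcal P(\nu x.H,L,H[L/x])=1$. A probabilistic applicative simulation is a preorder $\mathcal R$ on states such that $s\,\mathcal R\,t$ implies $\mathcal P(s,l,X)\le\mathcal P(t,l,\mathcal R(X))$ for all labels $l$ and all sets $X$ of states. Probabilistic applicative similarity (PAS) $\precsim$ is the union of all such simulations. It is extended to open terms $M,N$ with free variables among $x_1,\dots,x_n$ by $M\precsim N$ iff $\lambda x_1\ldots x_n.M\precsim\lambda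 x_1\ldots x_n.N$. Let $\mathbf I=\lambda x.x$, $\mathbf\Omega=(\lambda x.xx)(\lambda x.xx)$, $M=\lambda x.\,x(\mathbf\Omega\oplus\mathbf I)$ and $N=\lambda x.\,(x\mathbf\Omega\oplus x\mathbf I)$. **Theorem.** Neither $M\precsim N$ nor $N\precsim M$ holds, but $M\le_{\mathrm{cxt}}N$. Hence PAS is not complete with respect to the contextual preorder: it is not true that $P\le_{\mathrm{cxt}}Q$ implies $P\precsim Q$ for all $P,Q\in\Lambda_\oplus$. In particular PAS is not fully abstract: the relations $\precsim$ and $\le_{\mathrm{cxt}}$ on $\Lambda_\oplus$ do not coincide. -/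

import Mathlib

open scoped ENNReal

/-- Probabilistic λ-terms modulo renaming of bound variables, over the set of variables `x₀, x₁, …`,
in de Bruijn notation: under `k` binders an index `i < k` points to a binder, and the
index `k + i` is the free variable `xᵢ`. `choice M N` is `M ⊕ N`. -/
inductive Term : Type
  | var (i : ℕ) : Term
  | lam (M : Term) : Term
  | app (M N : Term) : Term
  | choice (M N : Term) : Term
  deriving Countable

namespace Term

/-- Lifting of a renaming under a binder. -/
def upRen (ρ : ℕ → ℕ) : ℕ → ℕ
  | 0 => 0
  | i + 1 => ρ i + 1

def rename : (ℕ → ℕ) → Term → Term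
  | ρ, var i => var (ρ i)
  | ρ, lam M => lam (rename (upRen ρ) M)
  | ρ, app M N => app (rename ρ M) (rename ρ N)
  | ρ, choice M N => choice (rename ρ M) (rename ρ N)

/-- Lifting of a substitution under a binder. -/
def upSub (σ : ℕ → Term) : ℕ → Term
  | 0 => var 0
  | i + 1 => rename Nat.succ (σ i)

/-- Capture-free simultaneous substitution. -/
def subst : (ℕ → Term) → Term → Term
  | σ, var i => σ i
  | σ, lam M => lam (subst (upSub σ) M)
  | σ, app M N => app (subst σ M) (subst σ N)
  | σ, choice M N => choice (subst σ M) (subst σ N)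

/-- The substitution which sends the innermost bound variable to `N`. -/
def instSub (N : Term) : ℕ → Term
  | 0 => N
  | i + 1 => var i

/-- `H[N/x]`, where `H` is the body of the abstraction `λx. H = lam H`. -/
def inst (H N : Term) : Term := subst (instSub N) H

/-- `λx. M` for the named variable `x = xⱼ`: all its free occurrences in `M` become bound. -/
def absVar (j : ℕ) (M : Term) : Term :=
  lam (rename (fun i => if i = j then 0 else i + 1) M)

/-- `λ y₁ … yₙ. M` for a list `y₁, …, yₙ` of named variables. -/
def absList (ys : List ℕ) (M : Term) : Term := ys.foldr absVar M

/-- The variable `xᵢ` occurs free in the term. -/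
def FreeIn : ℕ → Term → Prop
  | i, var j => i = j
  | i, lam M => FreeIn (i + 1) M
  | i, app M N => FreeIn i M ∨ FreeIn i N
  | i, choice M N => FreeIn i M ∨ FreeIn i N

def Closed (M : Term) : Prop := ∀ i, ¬ FreeIn i M

/-- Neutral terms `y N₁ … Nₘ`. -/
inductive IsNeutral : Term → Prop
  | var (i : ℕ) : IsNeutral (var i)
  | app {M : Term} (hM : IsNeutral M) (N : Term) : IsNeutral (app M N)

/-- Head normal forms `λ x₁ … xₙ. y N₁ … Nₘ`. -/
inductive IsHNF : Term → Prop
  | neutral {M : Term} (hM : IsNeutral M) : IsHNF M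
  | lam {M : Term} (hM : IsHNF M) : IsHNF (lam M)

end Term

open Term

/-- Head distributions: subprobability distributions over head normal forms,
extended by `0` to all terms. -/
structure HeadDist : Type where
  toFun : Term → ℝ≥0∞
  hnf_of_ne_zero : ∀ H, toFun H ≠ 0 → IsHNF H
  mass_le_one : ∑' H, toFun H ≤ 1

namespace HeadDist

instance : CoeFun HeadDist (fun _ => Term → ℝ≥0∞) := ⟨HeadDist.toFun⟩

/-- The total mass `∑ 𝒟` of a head distribution. -/
noncomputable def mass (D : HeadDist) : ℝ≥0∞ := ∑' H, D H

/-- The zero distribution `⊥`. -/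
def bot : HeadDist where
  toFun _ := 0
  hnf_of_ne_zero H h := absurd rfl h
  mass_le_one := by simp

open Classical in
/-- The distribution concentrated on the variable `xᵢ`. -/
noncomputable def var (i : ℕ) : HeadDist where
  toFun H := if H = Term.var i then 1 else 0
  hnf_of_ne_zero H h := by
    by_cases hH : H = Term.var i
    · subst hH; exact .neutral (.var i)
    · simp [hH] at h
  mass_le_one := by rw [tsum_ite_eq]

/-- The underlying function of `λx. 𝒟`. -/
def lamFun (D : Term → ℝ≥0∞) : Term → ℝ≥0∞
  | .lam H => D H
  | _ => 0

theorem tsum_lamFun (D : Term → ℝ≥0∞) : ∑' K, lamFun D K = ∑' H, D H := by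
  have hinj : Function.Injective Term.lam := fun a b h => by cases h; rfl
  have h := hinj.tsum_eq (f := lamFun D) (fun K hK => by
    cases K with
    | lam H => exact ⟨H, rfl⟩
    | _ => exact absurd rfl hK)
  rw [← h]; rfl

/-- `λx. 𝒟`. -/
def lam (D : HeadDist) : HeadDist where
  toFun := lamFun D
  hnf_of_ne_zero K h := by
    cases K with
    | lam H => exact .lam (D.hnf_of_ne_zero H h)
    | _ => exact absurd rfl h
  mass_le_one := by rw [tsum_lamFun]; exact D.mass_le_one

open Classical in
/-- The function
`∑_{λx.H} 𝒟(λx.H) ⬝ ℰ_H + ∑_{H neutral} 𝒟(H) ⬝ (H N)`, where `H N` stands for the distribution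
concentrated on that term. -/
noncomputable def appFun (D : Term → ℝ≥0∞) (E : Term → Term → ℝ≥0∞) (N : Term) (K : Term) :
    ℝ≥0∞ :=
  (∑' H, D (.lam H) * E H K) +
    ∑' H, if IsNeutral H ∧ K = Term.app H N then D H else 0

theorem tsum_appFun_le (D : Term → ℝ≥0∞) (E : Term → Term → ℝ≥0∞) (N : Term)
    (hE : ∀ H, ∑' K, E H K ≤ 1) : ∑' K, appFun D E N K ≤ ∑' H, D H := by
  classical
  unfold appFun
  rw [ENNReal.tsum_add, ENNReal.tsum_comm, ENNReal.tsum_comm (f := fun K H =>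
    if IsNeutral H ∧ K = Term.app H N then D H else 0)]
  have h1 : ∀ H, ∑' K, D (.lam H) * E H K ≤ D (.lam H) := fun H => by
    rw [ENNReal.tsum_mul_left]
    exact (mul_le_mul_right (hE H) _).trans_eq (mul_one _)
  have h2 : ∀ H, (∑' K, if IsNeutral H ∧ K = Term.app H N then D H else 0)
      = if IsNeutral H then D H else 0 := fun H => by
    by_cases hH : IsNeutral H
    · simp [hH]
    · simp [hH]
  simp_rw [h2]
  refine (add_le_add_left (ENNReal.tsum_le_tsum h1) _).trans ?_
  have h3 : ∑' H, D (.lam H) = ∑' K, lamFun (fun H => D (.lam H)) K := (tsum_lamFun _).symm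
  rw [h3, ← ENNReal.tsum_add]
  refine ENNReal.tsum_le_tsum fun K => ?_
  cases K with
  | lam H =>
    have : ¬ IsNeutral (Term.lam H) := by intro h; cases h
    simp [lamFun, this]
  | _ => simp only [lamFun, zero_add]; split_ifs <;> simp

/-- The conclusion of the application rule. -/
noncomputable def app (D : HeadDist) (E : Term → HeadDist) (N : Term) : HeadDist where
  toFun := appFun D (fun H => E H) N
  hnf_of_ne_zero K h := by
    by_contra hK
    apply h
    have h1 : ∀ H, (E H) K = 0 := fun H => by
      by_contra h0
      exact hK ((E H).hnf_of_ne_zero K h0)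
    have h2 : ∀ H, ¬ (IsNeutral H ∧ K = Term.app H N) := fun H hH => by
      apply hK
      rw [hH.2]
      exact .neutral (.app hH.1 N)
    simp [appFun, h1, h2]
  mass_le_one := (tsum_appFun_le _ _ _ fun H => (E H).mass_le_one).trans D.mass_le_one

/-- `½ ⬝ 𝒟 + ½ ⬝ ℰ`. -/
noncomputable def choice (D E : HeadDist) : HeadDist where
  toFun H := 2⁻¹ * D H + 2⁻¹ * E H
  hnf_of_ne_zero H h := by
    by_cases hD : D H = 0
    · by_cases hE : E H = 0
      · simp [hD, hE] at h
      · exact E.hnf_of_ne_zero H hE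
    · exact D.hnf_of_ne_zero H hD
  mass_le_one := by
    rw [ENNReal.tsum_add, ENNReal.tsum_mul_left, ENNReal.tsum_mul_left]
    calc _ ≤ (2⁻¹ : ℝ≥0∞) * 1 + 2⁻¹ * 1 :=
          add_le_add (mul_le_mul_right D.mass_le_one _) (mul_le_mul_right E.mass_le_one _)
      _ = 1 := by rw [mul_one, ENNReal.inv_two_add_inv_two]

end HeadDist

/-- Big-step approximation `M ⇓ 𝒟`. In the application rule only the values `E H` for
`λx.H` in the support of `D` are constrained, and only these contribute to `HeadDist.app D E N`. -/
inductive BigStep : Term → HeadDist → Prop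
  | bot (M : Term) : BigStep M HeadDist.bot
  | var (i : ℕ) : BigStep (Term.var i) (HeadDist.var i)
  | lam {M : Term} {D : HeadDist} (hM : BigStep M D) : BigStep (Term.lam M) D.lam
  | app {M N : Term} {D : HeadDist} {E : Term → HeadDist} (hM : BigStep M D)
      (hE : ∀ H, D (Term.lam H) ≠ 0 → BigStep (inst H N) (E H)) :
      BigStep (Term.app M N) (HeadDist.app D E N)
  | choice {M N : Term} {D E : HeadDist} (hM : BigStep M D) (hN : BigStep N E) :
      BigStep (Term.choice M N) (HeadDist.choice D E)

/-- The finite approximations of a term are directed. -/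
theorem BigStep.directed {M : Term} {D : HeadDist} (hD : BigStep M D) :
    ∀ {D' : HeadDist}, BigStep M D' →
      ∃ F, BigStep M F ∧ ∀ H, D H ≤ F H ∧ D' H ≤ F H := by
  classical
  induction hD with
  | bot M => exact fun {D'} h => ⟨D', h, fun H => ⟨zero_le, le_rfl⟩⟩
  | var i =>
    intro D' h
    refine ⟨_, .var i, fun H => ⟨le_rfl, ?_⟩⟩
    cases h with
    | bot => exact zero_le
    | var => exact le_rfl
  | lam hM ih =>
    intro D' h
    cases h with
    | bot => exact ⟨_, .lam hM, fun H => ⟨le_rfl, zero_le⟩⟩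
    | lam h =>
      obtain ⟨F, hF, hle⟩ := ih h
      refine ⟨_, .lam hF, fun H => ?_⟩
      cases H with
      | lam H => exact hle H
      | _ => exact ⟨le_rfl, le_rfl⟩
  | choice hM hN ihM ihN =>
    intro D' h
    cases h with
    | bot => exact ⟨_, .choice hM hN, fun H => ⟨le_rfl, zero_le⟩⟩
    | choice h1 h2 =>
      obtain ⟨F, hF, hle⟩ := ihM h1
      obtain ⟨G, hG, hle'⟩ := ihN h2
      exact ⟨_, .choice hF hG, fun H =>
        ⟨add_le_add (mul_le_mul_right (hle H).1 _) (mul_le_mul_right (hle' H).1 _),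
          add_le_add (mul_le_mul_right (hle H).2 _) (mul_le_mul_right (hle' H).2 _)⟩⟩
  | @app M N D E hM hE ihM ihE =>
    intro D' h
    cases h with
    | bot => exact ⟨_, .app hM hE, fun H => ⟨le_rfl, zero_le⟩⟩
    | @app _ _ D₂ E₂ h1 h2 =>
      obtain ⟨F, hF, hle⟩ := ihM h1
      have key : ∀ H, ∃ G : HeadDist, BigStep (inst H N) G ∧
          (D (Term.lam H) ≠ 0 → ∀ K, E H K ≤ G K) ∧
          (D₂ (Term.lam H) ≠ 0 → ∀ K, E₂ H K ≤ G K) := by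
        intro H
        by_cases a : D (Term.lam H) = 0
        · by_cases b : D₂ (Term.lam H) = 0
          · exact ⟨_, .bot _, fun h => absurd a h, fun h => absurd b h⟩
          · exact ⟨_, h2 H b, fun h => absurd a h, fun _ K => le_rfl⟩
        · by_cases b : D₂ (Term.lam H) = 0
          · exact ⟨_, hE H a, fun _ K => le_rfl, fun h => absurd b h⟩
          · obtain ⟨G, hG, hG'⟩ := ihE H a (h2 H b)
            exact ⟨G, hG, fun _ K => (hG' K).1, fun _ K => (hG' K).2⟩
      choose G hG hG1 hG2 using key
      have mono : ∀ (D₀ : HeadDist) (E₀ : Term → HeadDist), (∀ H, D₀ H ≤ F H) →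
          (∀ H, D₀ (Term.lam H) ≠ 0 → ∀ K, E₀ H K ≤ G H K) →
          ∀ K, HeadDist.app D₀ E₀ N K ≤ HeadDist.app F G N K := by
        intro D₀ E₀ h0 h0' K
        refine add_le_add (ENNReal.tsum_le_tsum fun H => ?_) (ENNReal.tsum_le_tsum fun H => ?_)
        · by_cases a : D₀ (Term.lam H) = 0
          · rw [a, zero_mul]; exact zero_le
          · exact mul_le_mul' (h0 _) (h0' H a K)
        · split_ifs
          · exact h0 H
          · exact le_rfl
      exact ⟨_, .app hF (fun H _ => hG H), fun K =>
        ⟨mono D E (fun H => (hle H).1) hG1 K, mono D₂ E₂ (fun H => (hle H).2) hG2 K⟩⟩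

/-- The big-step semantics `⟦M⟧`: the supremum of the directed set of all head distributions `𝒟`
with `M ⇓ 𝒟`, which is computed pointwise. -/
noncomputable def eval (M : Term) : HeadDist where
  toFun H := ⨆ D : {D : HeadDist // BigStep M D}, D.1 H
  hnf_of_ne_zero H h := by
    by_contra hH
    apply h
    refine le_antisymm (iSup_le fun D => ?_) zero_le
    by_contra h0
    exact hH (D.1.hnf_of_ne_zero H fun h1 => h0 h1.le)
  mass_le_one := by
    rw [ENNReal.tsum_eq_iSup_sum]
    refine iSup_le fun s => ?_
    rw [ENNReal.finsetSum_iSup fun D D' => ?_]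
    · exact iSup_le fun D => (ENNReal.sum_le_tsum s).trans D.1.mass_le_one
    · obtain ⟨F, hF, hle⟩ := D.2.directed D'.2
      exact ⟨⟨F, hF⟩, hle⟩

/-- One-hole contexts. The binders carry names, since they may capture free variables of the
term that is put into the hole. -/
inductive Ctx : Type
  | hole : Ctx
  | lam (j : ℕ) (C : Ctx) : Ctx
  | appL (C : Ctx) (M : Term) : Ctx
  | appR (M : Term) (C : Ctx) : Ctx
  | choiceL (C : Ctx) (M : Term) : Ctx
  | choiceR (M : Term) (C : Ctx) : Ctx

/-- `C[M]`, with capture. -/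
def Ctx.fill : Ctx → Term → Term
  | .hole, M => M
  | .lam j C, M => Term.absVar j (C.fill M)
  | .appL C P, M => Term.app (C.fill M) P
  | .appR P C, M => Term.app P (C.fill M)
  | .choiceL C P, M => Term.choice (C.fill M) P
  | .choiceR P C, M => Term.choice P (C.fill M)

/-- The contextual preorder. -/
def CtxLE (M N : Term) : Prop :=
  ∀ C : Ctx, (eval (C.fill M)).mass ≤ (eval (C.fill N)).mass

/-- Labelled Markov chains with a countable set `S` of states and a set `L` of labels. -/
structure LabelledMarkovChain (S : Type*) [Countable S] (L : Type*) where
  prob : S → L → S → ℝ≥0∞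
  sum_le_one : ∀ s l, ∑' t, prob s l t ≤ 1

namespace LabelledMarkovChain

variable {S : Type*} [Countable S] {L : Type*}

/-- `𝒫(s, l, X)` for a set `X` of states. -/
noncomputable def probSet (𝓜 : LabelledMarkovChain S L) (s : S) (l : L) (X : Set S) : ℝ≥0∞ :=
  ∑' t : X, 𝓜.prob s l t

/-- Probabilistic simulations. -/
structure IsSimulation (𝓜 : LabelledMarkovChain S L) (R : S → S → Prop) : Prop where
  refl : ∀ s, R s s
  trans : ∀ s t u, R s t → R t u → R s u
  sim : ∀ s t, R s t → ∀ (X : Set S) (l : L),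
    𝓜.probSet s l X ≤ 𝓜.probSet t l {v | ∃ u ∈ X, R u v}

/-- Probabilistic similarity. -/
def Similar (𝓜 : LabelledMarkovChain S L) (s t : S) : Prop :=
  ∃ R, 𝓜.IsSimulation R ∧ R s t

end LabelledMarkovChain

/-- Closed terms. -/
abbrev ClosedTerm : Type := {M : Term // M.Closed}

/-- Distinguished closed head normal forms: `νx. H` is represented by the body `H`. -/
abbrev DistHNF : Type := {H : Term // IsHNF (Term.lam H) ∧ (Term.lam H).Closed}

open Classical in
/-- The transition matrix of the Markov chain of probabilistic λ-terms. The label `none` is `τ`,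
and the label `some L` is the closed term `L`. -/
noncomputable def transProb :
    ClosedTerm ⊕ DistHNF → Option ClosedTerm → ClosedTerm ⊕ DistHNF → ℝ≥0∞
  | .inl M, none, .inr H => eval M.1 (Term.lam H.1)
  | .inr H, some L, .inl P => if P.1 = inst H.1 L.1 then 1 else 0
  | _, _, _ => 0

theorem tsum_transProb_le_one (s : ClosedTerm ⊕ DistHNF) (l : Option ClosedTerm) :
    ∑' t, transProb s l t ≤ 1 := by
  classical
  rw [ENNReal.summable.tsum_sum ENNReal.summable]
  rcases s with M | H <;> rcases l with _ | L
  · simp only [transProb, tsum_zero, zero_add]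
    have hinj : Function.Injective (fun H : DistHNF => Term.lam H.1) := fun a b h =>
      Subtype.ext (Term.lam.inj h)
    exact (ENNReal.tsum_comp_le_tsum_of_injective hinj _).trans (eval M.1).mass_le_one
  · simp [transProb]
  · simp [transProb]
  · simp only [transProb, tsum_zero, add_zero]
    refine (ENNReal.tsum_comp_le_tsum_of_injective Subtype.val_injective
      (fun P : Term => if P = inst H.1 L.1 then (1 : ℝ≥0∞) else 0)).trans ?_
    rw [tsum_ite_eq]

/-- The labelled Markov chain of probabilistic λ-terms. -/
noncomputable def termChain :
    LabelledMarkovChain (ClosedTerm ⊕ DistHNF) (Option ClosedTerm) where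
  prob := transProb
  sum_le_one := tsum_transProb_le_one

/-- Probabilistic applicative similarity (PAS) of closed terms. -/
def PAS (M N : ClosedTerm) : Prop := termChain.Similar (.inl M) (.inl N)

namespace Term

theorem freeIn_rename {M : Term} : ∀ {ρ : ℕ → ℕ} {i : ℕ},
    FreeIn i (rename ρ M) → ∃ j, FreeIn j M ∧ ρ j = i := by
  induction M with
  | var k => exact fun {ρ i} h => ⟨k, rfl, Eq.symm h⟩
  | lam M ih =>
    intro ρ i h
    obtain ⟨j, hj, hi⟩ := ih h
    cases j with
    | zero => simp [upRen] at hi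
    | succ j => exact ⟨j, hj, by simpa [upRen] using hi⟩
  | app M N ihM ihN =>
    intro ρ i h
    rcases h with h | h
    · obtain ⟨j, hj, hi⟩ := ihM h; exact ⟨j, .inl hj, hi⟩
    · obtain ⟨j, hj, hi⟩ := ihN h; exact ⟨j, .inr hj, hi⟩
  | choice M N ihM ihN =>
    intro ρ i h
    rcases h with h | h
    · obtain ⟨j, hj, hi⟩ := ihM h; exact ⟨j, .inl hj, hi⟩
    · obtain ⟨j, hj, hi⟩ := ihN h; exact ⟨j, .inr hj, hi⟩

theorem freeIn_absVar {M : Term} {i j : ℕ} (h : FreeIn i (absVar j M)) : FreeIn i M ∧ i ≠ j := by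
  obtain ⟨k, hk, hi⟩ := freeIn_rename (show FreeIn (i + 1) (rename _ M) from h)
  by_cases hkj : k = j
  · simp [hkj] at hi
  · simp only [hkj, if_false] at hi
    have : k = i := by omega
    subst this
    exact ⟨hk, hkj⟩

theorem closed_absList {M : Term} {ys : List ℕ} (h : ∀ i, FreeIn i M → i ∈ ys) :
    (absList ys M).Closed := by
  have key : ∀ (zs : List ℕ) (i : ℕ), FreeIn i (absList zs M) → FreeIn i M ∧ i ∉ zs := by
    intro zs
    induction zs with
    | nil => exact fun i hi => ⟨hi, List.not_mem_nil⟩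
    | cons z zs ih =>
      intro i hi
      obtain ⟨h1, h2⟩ := freeIn_absVar (show FreeIn i (absVar z (absList zs M)) from hi)
      obtain ⟨h3, h4⟩ := ih i h1
      exact ⟨h3, by simp [h2, h4]⟩
  intro i hi
  exact (key ys i hi).2 (h i (key ys i hi).1)

end Term

/-- PAS of arbitrary terms: whenever the free variables of `M` and `N` are among the distinct
variables `y₁, …, yₙ`, the closed terms `λ y₁ … yₙ. M` and `λ y₁ … yₙ. N` are related. -/
def OpenPAS (M N : Term) : Prop :=
  ∀ (ys : List ℕ) (hM : ∀ i, FreeIn i M → i ∈ ys) (hN : ∀ i, FreeIn i N → i ∈ ys), ys.Nodup →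
    PAS ⟨absList ys M, closed_absList hM⟩ ⟨absList ys N, closed_absList hN⟩

/-- `I = λx. x`. -/
def termI : Term := lam (var 0)

/-- `Δ = λx. x x`. -/
def termDelta : Term := lam (app (var 0) (var 0))

/-- `Ω = Δ Δ`. -/
def termOmega : Term := app termDelta termDelta

/-- `M = λx. x (Ω ⊕ I)`. -/
def witnessM : ClosedTerm :=
  ⟨lam (app (var 0) (choice termOmega termI)), fun i => by
    simp [FreeIn, termOmega, termDelta, termI]⟩

/-- `N = λx. (x Ω ⊕ x I)`. -/
def witnessN : ClosedTerm :=
  ⟨lam (choice (app (var 0) termOmega) (app (var 0) termI)), fun i => by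
    simp [FreeIn, termOmega, termDelta, termI]⟩

/-! `PAS` sees when a choice is made. With probability 1, `M` evaluates to `νx. x(Ω ⊕ I)`, while `N`
evaluates to `νx. xΩ` and to `νx. xI`, each with probability 1/2. Since total mass is at most 1, a
simulation of `M` by `N` must relate `νx. x(Ω ⊕ I)` to `νx. xΩ`, and one of `N` by `M` must relate
`νx. xI` to `νx. x(Ω ⊕ I)` (`rel_of_one_lt`). Passing `I` refutes both: the probabilities of
convergence are 1/2 against 0, and 1 against 1/2 (`not_rel_distVarApp`).

For the contextual preorder, evaluation is replaced by a head reduction machine with a stack, whose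
probability of convergence is the mass of the semantics (`mass_eval`). Terms obtained from one
multi-hole context by different fillings run in lockstep until a hole reaches head position. An
inequality between fillings thus follows by induction on the number of steps once it is checked
there (`Fill.headProbAt_le_sum`).

This is applied three times. First, `Ω` lies below `I`. Next, a context filled with `Ω ⊕ I`
converges at most as often as the average of its fillings with `Ω` and with `I`
(`headProb_choiceFamily_le`): at the first use, `Ω` is fatal, and after choosing `I` it is best for
all later copies to be `I` as well. Finally, if `M` meets an argument `P`, it runs `P(Ω ⊕ I)`, which
by the second inequality is bounded by the average of `PΩ` and `PI`, that is, by `NP`. -/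

namespace Term

/-! ### Calculus of renamings and substitutions -/

theorem rename_ext {M : Term} : ∀ {ρ ρ' : ℕ → ℕ}, (∀ i, FreeIn i M → ρ i = ρ' i) →
    rename ρ M = rename ρ' M := by
  induction M with
  | var i => exact fun h => congrArg var (h i rfl)
  | lam M ih =>
    refine fun h => congrArg lam (ih fun i hi => ?_)
    cases i with
    | zero => rfl
    | succ i => exact congrArg (· + 1) (h i hi)
  | app M N ihM ihN =>
    exact fun h => congrArg₂ app (ihM fun i hi => h i (.inl hi)) (ihN fun i hi => h i (.inr hi))
  | choice M N ihM ihN =>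
    exact fun h => congrArg₂ choice (ihM fun i hi => h i (.inl hi)) (ihN fun i hi => h i (.inr hi))

theorem subst_ext {M : Term} : ∀ {σ σ' : ℕ → Term}, (∀ i, FreeIn i M → σ i = σ' i) →
    subst σ M = subst σ' M := by
  induction M with
  | var i => exact fun h => h i rfl
  | lam M ih =>
    refine fun h => congrArg lam (ih fun i hi => ?_)
    cases i with
    | zero => rfl
    | succ i => exact congrArg (rename Nat.succ) (h i hi)
  | app M N ihM ihN =>
    exact fun h => congrArg₂ app (ihM fun i hi => h i (.inl hi)) (ihN fun i hi => h i (.inr hi))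
  | choice M N ihM ihN =>
    exact fun h => congrArg₂ choice (ihM fun i hi => h i (.inl hi)) (ihN fun i hi => h i (.inr hi))

theorem upRen_id : upRen id = id := by
  funext i; cases i <;> rfl

theorem upSub_var : upSub var = var := by
  funext i; cases i <;> rfl

theorem rename_id (M : Term) : rename id M = M := by
  induction M with
  | var i => rfl
  | lam M ih => simp only [rename, upRen_id, ih]
  | app M N ihM ihN => simp only [rename, ihM, ihN]
  | choice M N ihM ihN => simp only [rename, ihM, ihN]

theorem subst_var (M : Term) : subst var M = M := by
  induction M with
  | var i => rfl
  | lam M ih => simp only [subst, upSub_var, ih]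
  | app M N ihM ihN => simp only [subst, ihM, ihN]
  | choice M N ihM ihN => simp only [subst, ihM, ihN]

theorem Closed.rename_eq {M : Term} (h : M.Closed) (ρ : ℕ → ℕ) : rename ρ M = M :=
  (rename_ext fun i hi => absurd hi (h i)).trans (rename_id M)

theorem Closed.subst_eq {M : Term} (h : M.Closed) (σ : ℕ → Term) : subst σ M = M :=
  (subst_ext fun i hi => absurd hi (h i)).trans (subst_var M)

theorem rename_rename (M : Term) : ∀ ρ ρ' : ℕ → ℕ,
    rename ρ' (rename ρ M) = rename (ρ' ∘ ρ) M := by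
  induction M with
  | var i => exact fun _ _ => rfl
  | lam M ih =>
    intro ρ ρ'
    have : upRen ρ' ∘ upRen ρ = upRen (ρ' ∘ ρ) := by funext i; cases i <;> rfl
    simp only [rename, ih, this]
  | app M N ihM ihN => intro ρ ρ'; simp only [rename, ihM, ihN]
  | choice M N ihM ihN => intro ρ ρ'; simp only [rename, ihM, ihN]

theorem subst_rename (M : Term) : ∀ (ρ : ℕ → ℕ) (σ : ℕ → Term),
    subst σ (rename ρ M) = subst (σ ∘ ρ) M := by
  induction M with
  | var i => exact fun _ _ => rfl
  | lam M ih =>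
    intro ρ σ
    have : upSub σ ∘ upRen ρ = upSub (σ ∘ ρ) := by funext i; cases i <;> rfl
    simp only [rename, subst, ih, this]
  | app M N ihM ihN => intro ρ σ; simp only [rename, subst, ihM, ihN]
  | choice M N ihM ihN => intro ρ σ; simp only [rename, subst, ihM, ihN]

theorem rename_subst (M : Term) : ∀ (ρ : ℕ → ℕ) (σ : ℕ → Term),
    rename ρ (subst σ M) = subst (fun i => rename ρ (σ i)) M := by
  induction M with
  | var i => exact fun _ _ => rfl
  | lam M ih =>
    intro ρ σ
    have : (fun i => rename (upRen ρ) (upSub σ i)) = upSub (fun i => rename ρ (σ i)) := by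
      funext i
      cases i with
      | zero => rfl
      | succ i =>
        simp only [upSub, rename_rename]
        rfl
    simp only [rename, subst, ih, this]
  | app M N ihM ihN => intro ρ σ; simp only [rename, subst, ihM, ihN]
  | choice M N ihM ihN => intro ρ σ; simp only [rename, subst, ihM, ihN]

theorem subst_subst (M : Term) : ∀ σ τ : ℕ → Term,
    subst τ (subst σ M) = subst (fun i => subst τ (σ i)) M := by
  induction M with
  | var i => exact fun _ _ => rfl
  | lam M ih =>
    intro σ τ
    have : (fun i => subst (upSub τ) (upSub σ i)) = upSub (fun i => subst τ (σ i)) := by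
      funext i
      cases i with
      | zero => rfl
      | succ i =>
        simp only [upSub, rename_subst, subst_rename]
        rfl
    simp only [subst, ih, this]
  | app M N ihM ihN => intro σ τ; simp only [subst, ihM, ihN]
  | choice M N ihM ihN => intro σ τ; simp only [subst, ihM, ihN]

/-- The substitution `σ` extended by `N` for the innermost bound variable. -/
def consSub (N : Term) (σ : ℕ → Term) : ℕ → Term
  | 0 => N
  | i + 1 => σ i

theorem inst_subst_upSub (M N : Term) (σ : ℕ → Term) :
    inst (subst (upSub σ) M) N = subst (consSub N σ) M := by
  rw [inst, subst_subst]
  congr 1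
  funext i
  cases i with
  | zero => rfl
  | succ i =>
    simp only [upSub, consSub, subst_rename]
    exact subst_var _

theorem subst_inst (M N : Term) (σ : ℕ → Term) :
    subst σ (inst M N) = inst (subst (upSub σ) M) (subst σ N) := by
  rw [inst_subst_upSub, inst, subst_subst]
  congr 1
  funext i
  cases i <;> rfl

end Term

/-! ### The head reduction machine -/

/-- The probability that the term `M`, applied to the terms of the stack, reaches a head normal
form within `n` steps of a head reduction machine. -/
noncomputable def headProbAt : ℕ → Term → List Term → ℝ≥0∞
  | 0, _, _ => 0
  | _ + 1, .var _, _ => 1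
  | n + 1, .lam M, [] => headProbAt n M []
  | n + 1, .lam M, N :: S => headProbAt n (inst M N) S
  | n + 1, .app M N, S => headProbAt n M (N :: S)
  | n + 1, .choice M N, S => 2⁻¹ * headProbAt n M S + 2⁻¹ * headProbAt n N S

theorem headProbAt_le_succ (n : ℕ) :
    ∀ (M : Term) (S : List Term), headProbAt n M S ≤ headProbAt (n + 1) M S := by
  induction n with
  | zero => exact fun _ _ => zero_le
  | succ n ih =>
    intro M S
    cases M with
    | var i => exact le_rfl
    | lam M => cases S <;> exact ih _ _
    | app M N => exact ih _ _
    | choice M N => exact add_le_add (mul_le_mul_right (ih _ _) _) (mul_le_mul_right (ih _ _) _)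

theorem headProbAt_mono (M : Term) (S : List Term) : Monotone fun n => headProbAt n M S :=
  monotone_nat_of_le_succ fun n => headProbAt_le_succ n M S

theorem headProbAt_le_one (n : ℕ) :
    ∀ (M : Term) (S : List Term), headProbAt n M S ≤ 1 := by
  induction n with
  | zero => exact fun _ _ => zero_le
  | succ n ih =>
    intro M S
    cases M with
    | var i => exact le_rfl
    | lam M => cases S <;> exact ih _ _
    | app M N => exact ih _ _
    | choice M N =>
      calc _ ≤ (2⁻¹ : ℝ≥0∞) * 1 + 2⁻¹ * 1 :=
            add_le_add (mul_le_mul_right (ih _ _) _) (mul_le_mul_right (ih _ _) _)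
        _ = 1 := by rw [mul_one, ENNReal.inv_two_add_inv_two]

/-- The probability that `M`, applied to the terms of the stack, reaches a head normal form. -/
noncomputable def headProb (M : Term) (S : List Term) : ℝ≥0∞ := ⨆ n, headProbAt n M S

theorem headProb_eq_iSup_succ (M : Term) (S : List Term) :
    headProb M S = ⨆ n, headProbAt (n + 1) M S :=
  ((headProbAt_mono M S).iSup_nat_add 1).symm

theorem headProb_var (i : ℕ) (S : List Term) : headProb (.var i) S = 1 := by
  rw [headProb_eq_iSup_succ]
  exact iSup_const

theorem headProb_lam_nil (M : Term) : headProb (.lam M) [] = headProb M [] :=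
  headProb_eq_iSup_succ _ _

theorem headProb_lam_cons (M N : Term) (S : List Term) :
    headProb (.lam M) (N :: S) = headProb (inst M N) S :=
  headProb_eq_iSup_succ _ _

theorem headProb_app (M N : Term) (S : List Term) :
    headProb (.app M N) S = headProb M (N :: S) :=
  headProb_eq_iSup_succ _ _

theorem headProb_choice (M N : Term) (S : List Term) :
    headProb (.choice M N) S = 2⁻¹ * headProb M S + 2⁻¹ * headProb N S := by
  rw [headProb_eq_iSup_succ, headProb, headProb, ENNReal.mul_iSup, ENNReal.mul_iSup,
    ENNReal.iSup_add_iSup_of_monotone]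
  · rfl
  · exact fun a b h => mul_le_mul_right (headProbAt_mono M S h) _
  · exact fun a b h => mul_le_mul_right (headProbAt_mono N S h) _

theorem headProb_neutral {M : Term} (hM : IsNeutral M) : ∀ S, headProb M S = 1 := by
  induction hM with
  | var i => exact headProb_var i
  | app hM N ih => exact fun S => (headProb_app _ _ _).trans (ih _)

theorem headProb_hnf {M : Term} (hM : IsHNF M) : headProb M [] = 1 := by
  induction hM with
  | neutral hM => exact headProb_neutral hM []
  | lam hM ih => exact (headProb_lam_nil _).trans ih

/-! ### Sums against head distributions and adequacy of the machine -/

namespace HeadDist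

theorem tsum_lamFun_mul (D f : Term → ℝ≥0∞) :
    ∑' K, lamFun D K * f K = ∑' H, D H * f (.lam H) := by
  rw [← tsum_lamFun fun H => D H * f (.lam H)]
  refine tsum_congr fun K => ?_
  cases K <;> simp [lamFun]

theorem not_isNeutral_lam (H : Term) : ¬ IsNeutral (.lam H) := nofun

open Classical in
-- The support consists of head normal forms, so each term in it is an abstraction or neutral. This
-- matches the two sums in the application rule.
theorem tsum_mul_eq (D : HeadDist) (f : Term → ℝ≥0∞) :
    ∑' H, D H * f H =
      ∑' H, D (.lam H) * f (.lam H) + ∑' H, if IsNeutral H then D H * f H else 0 := by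
  rw [← tsum_lamFun_mul (fun H => D (.lam H)) f, ← ENNReal.tsum_add]
  refine tsum_congr fun K => ?_
  by_cases h : D K = 0
  · cases K <;> simp [h, lamFun]
  · cases D.hnf_of_ne_zero K h with
    | neutral hK =>
      cases hK <;> simp [lamFun, IsNeutral.var, IsNeutral.app, *]
    | lam hK => simp [lamFun, not_isNeutral_lam]

open Classical in
theorem tsum_app_mul (D : HeadDist) (E : Term → HeadDist) (N : Term) (f : Term → ℝ≥0∞) :
    ∑' K, app D E N K * f K =
      ∑' H, D (.lam H) * ∑' K, E H K * f K +
        ∑' H, if IsNeutral H then D H * f (.app H N) else 0 := by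
  change ∑' K, appFun D (fun H => E H) N K * f K = _
  simp_rw [appFun, add_mul, ENNReal.tsum_add, ← ENNReal.tsum_mul_right, ← ENNReal.tsum_mul_left]
  rw [ENNReal.tsum_comm, ENNReal.tsum_comm (f := fun K H =>
    (if IsNeutral H ∧ K = Term.app H N then D H else 0) * f K)]
  congr 1
  · simp_rw [mul_assoc]
  · refine tsum_congr fun H => ?_
    by_cases h : IsNeutral H
    · simp [h]
    · simp [h]

theorem tsum_choice_mul (D E : HeadDist) (f : Term → ℝ≥0∞) :
    ∑' K, choice D E K * f K = 2⁻¹ * ∑' K, D K * f K + 2⁻¹ * ∑' K, E K * f K := by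
  change ∑' K, (2⁻¹ * D K + 2⁻¹ * E K) * f K = _
  simp_rw [add_mul, ENNReal.tsum_add, mul_assoc, ENNReal.tsum_mul_left]

theorem tsum_var_mul (i : ℕ) (f : Term → ℝ≥0∞) : ∑' K, var i K * f K = f (.var i) := by
  classical
  change ∑' K, (if K = Term.var i then (1 : ℝ≥0∞) else 0) * f K = _
  simp

end HeadDist

/-- Soundness half of adequacy. The stack is general because an application pushes its argument, and
the substitution is general because an abstraction that meets an argument continues with its
instantiated body. -/
theorem BigStep.tsum_mul_headProb_le {M : Term} {D : HeadDist} (h : BigStep M D) :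
    ∀ (σ : ℕ → Term) (S : List Term),
      ∑' H, D H * headProb (subst σ H) S ≤ headProb (subst σ M) S := by
  classical
  induction h with
  | bot M => intro σ S; simp [HeadDist.bot]
  | var i => intro σ S; rw [HeadDist.tsum_var_mul]
  | @lam M D hM ih =>
    intro σ S
    refine (HeadDist.tsum_lamFun_mul D _).trans_le ?_
    cases S with
    | nil => simpa only [subst, headProb_lam_nil] using ih (upSub σ) []
    | cons N S =>
      simpa only [subst, headProb_lam_cons, inst_subst_upSub] using ih (consSub N σ) S
  | @app M N D E hM hE ihM ihE =>
    intro σ S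
    rw [HeadDist.tsum_app_mul, subst, headProb_app]
    refine le_trans ?_ (ihM σ (subst σ N :: S))
    rw [HeadDist.tsum_mul_eq]
    refine add_le_add (ENNReal.tsum_le_tsum fun H => ?_) (ENNReal.tsum_le_tsum fun H => ?_)
    · by_cases h : D (.lam H) = 0
      · simp [h]
      · refine mul_le_mul_right ((ihE H h σ S).trans_eq ?_) _
        rw [subst, headProb_lam_cons, subst_inst]
    · rw [subst, headProb_app]
  | choice hM hN ihM ihN =>
    intro σ S
    rw [HeadDist.tsum_choice_mul, subst, headProb_choice]
    exact add_le_add (mul_le_mul_right (ihM σ S) _) (mul_le_mul_right (ihN σ S) _)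

theorem BigStep.mass_le_headProb {M : Term} {D : HeadDist} (h : BigStep M D) :
    D.mass ≤ headProb M [] := by
  refine le_trans ?_ ((h.tsum_mul_headProb_le Term.var []).trans_eq (by rw [subst_var]))
  refine ENNReal.tsum_le_tsum fun H => ?_
  by_cases h0 : D H = 0
  · simp [h0]
  · rw [subst_var, headProb_hnf (D.hnf_of_ne_zero H h0), mul_one]

/-- Completeness half of adequacy: `n` machine steps are captured by one finite derivation. The
distribution is chosen before the substitution and the stack, since the derivation for a subterm
cannot depend on what surrounds it. -/
theorem exists_bigStep_headProbAt_le (n : ℕ) : ∀ M : Term, ∃ D : HeadDist, BigStep M D ∧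
    ∀ (σ : ℕ → Term) (S : List Term),
      headProbAt n (subst σ M) S ≤ ∑' H, D H * headProbAt n (subst σ H) S := by
  classical
  induction n with
  | zero => exact fun M => ⟨_, .bot M, fun _ _ => zero_le⟩
  | succ n ih =>
    have ih' : ∀ M : Term, ∃ D : HeadDist, BigStep M D ∧ ∀ (σ : ℕ → Term) (S : List Term),
        headProbAt n (subst σ M) S ≤ ∑' H, D H * headProbAt (n + 1) (subst σ H) S := fun M => by
      obtain ⟨D, hD, h⟩ := ih M
      exact ⟨D, hD, fun σ S => (h σ S).trans
        (ENNReal.tsum_le_tsum fun H => mul_le_mul_right (headProbAt_le_succ _ _ _) _)⟩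
    intro M
    cases M with
    | var i => exact ⟨_, .var i, fun σ S => (HeadDist.tsum_var_mul i _).ge⟩
    | lam M =>
      obtain ⟨D, hD, h⟩ := ih M
      refine ⟨_, .lam hD, fun σ S => ?_⟩
      refine le_of_le_of_eq ?_ (HeadDist.tsum_lamFun_mul D _).symm
      cases S with
      | nil => exact h (upSub σ) []
      | cons N S =>
        simpa only [subst, headProbAt, inst_subst_upSub] using h (consSub N σ) S
    | app M N =>
      obtain ⟨D, hD, h⟩ := ih M
      choose E hE h' using ih'
      refine ⟨_, .app hD fun H _ => hE (inst H N), fun σ S => ?_⟩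
      rw [HeadDist.tsum_app_mul]
      refine (h σ (subst σ N :: S)).trans ?_
      rw [HeadDist.tsum_mul_eq]
      refine add_le_add (ENNReal.tsum_le_tsum fun H => mul_le_mul_right ?_ _) le_rfl
      -- The extra step is the β-step, which turns `λx.H` with `N` on the stack into `H[N/x]`; the
      -- induction hypothesis for `n` then applies to that term.
      refine (headProbAt_le_succ _ _ _).trans (le_trans ?_ (h' (inst H N) σ S))
      rw [subst_inst]
      rfl
    | choice M N =>
      obtain ⟨D, hD, h⟩ := ih' M
      obtain ⟨E, hE, h'⟩ := ih' N
      refine ⟨_, .choice hD hE, fun σ S => ?_⟩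
      rw [HeadDist.tsum_choice_mul]
      exact add_le_add (mul_le_mul_right (h σ S) _) (mul_le_mul_right (h' σ S) _)

theorem BigStep.le_eval {M : Term} {D : HeadDist} (h : BigStep M D) (H : Term) :
    D H ≤ eval M H :=
  le_iSup (fun D : {D : HeadDist // BigStep M D} => D.1 H) ⟨D, h⟩

/-- Adequacy of the head reduction machine. -/
theorem mass_eval (M : Term) : (eval M).mass = headProb M [] := by
  apply le_antisymm
  · change ∑' H, ⨆ D : {D : HeadDist // BigStep M D}, D.1 H ≤ _
    rw [ENNReal.tsum_eq_iSup_sum]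
    refine iSup_le fun s => ?_
    rw [ENNReal.finsetSum_iSup fun D D' => ?_]
    · exact iSup_le fun D => (ENNReal.sum_le_tsum s).trans D.2.mass_le_headProb
    · obtain ⟨F, hF, hle⟩ := D.2.directed D'.2
      exact ⟨⟨F, hF⟩, hle⟩
  · refine iSup_le fun n => ?_
    obtain ⟨D, hD, h⟩ := exists_bigStep_headProbAt_le n M
    have h1 := h Term.var []
    rw [subst_var] at h1
    refine h1.trans (ENNReal.tsum_le_tsum fun H => ?_)
    exact ((mul_le_mul_right (headProbAt_le_one _ _ _) _).trans_eq (mul_one _)).trans (hD.le_eval H)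


/-! ### Multi-hole contexts and simultaneous fillings -/

section Fill

variable {ι : Type*}

/-- The families of terms obtained by filling the holes of a multi-hole context with `A i`. -/
inductive Fill (A : ι → Term) : (ι → Term) → Prop
  | hole : Fill A A
  | var (j : ℕ) : Fill A fun _ => .var j
  | lam {T : ι → Term} (hT : Fill A T) : Fill A fun i => .lam (T i)
  | app {T U : ι → Term} (hT : Fill A T) (hU : Fill A U) : Fill A fun i => .app (T i) (U i)
  | choice {T U : ι → Term} (hT : Fill A T) (hU : Fill A U) : Fill A fun i => .choice (T i) (U i)

/-- The families of stacks obtained by filling the holes of a stack of multi-hole contexts. -/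
inductive FillStack (A : ι → Term) : (ι → List Term) → Prop
  | nil : FillStack A fun _ => []
  | cons {T : ι → Term} {S : ι → List Term} (hT : Fill A T) (hS : FillStack A S) :
      FillStack A fun i => T i :: S i

namespace Fill

variable {A : ι → Term}

theorem const (A : ι → Term) (M : Term) : Fill A fun _ => M := by
  induction M with
  | var j => exact .var j
  | lam M ih => exact .lam ih
  | app M N ihM ihN => exact .app ihM ihN
  | choice M N ihM ihN => exact .choice ihM ihN

/-- Closed fillings are unaffected by renaming, and likewise by substitution, so holes need not
record the binders above them. This is what makes families stable under β-steps. -/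
theorem rename (hA : ∀ i, (A i).Closed) {T : ι → Term} (hT : Fill A T) :
    ∀ ρ : ℕ → ℕ, Fill A fun i => (T i).rename ρ := by
  induction hT with
  | hole => exact fun ρ => by simpa only [(hA _).rename_eq] using Fill.hole
  | var j => exact fun ρ => .var (ρ j)
  | lam hT ih => exact fun ρ => .lam (ih _)
  | app hT hU ihT ihU => exact fun ρ => .app (ihT ρ) (ihU ρ)
  | choice hT hU ihT ihU => exact fun ρ => .choice (ihT ρ) (ihU ρ)

theorem subst (hA : ∀ i, (A i).Closed) {T : ι → Term} (hT : Fill A T) :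
    ∀ σ : ι → ℕ → Term, (∀ j, Fill A fun i => σ i j) → Fill A fun i => (T i).subst (σ i) := by
  induction hT with
  | hole => exact fun σ _ => by simpa only [(hA _).subst_eq] using Fill.hole
  | var j => exact fun σ hσ => hσ j
  | lam hT ih =>
    refine fun σ hσ => .lam (ih _ fun j => ?_)
    cases j with
    | zero => exact .var 0
    | succ j => exact (hσ j).rename hA _
  | app hT hU ihT ihU => exact fun σ hσ => .app (ihT σ hσ) (ihU σ hσ)
  | choice hT hU ihT ihU => exact fun σ hσ => .choice (ihT σ hσ) (ihU σ hσ)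

theorem inst (hA : ∀ i, (A i).Closed) {T U : ι → Term} (hT : Fill A T) (hU : Fill A U) :
    Fill A fun i => (T i).inst (U i) := by
  refine hT.subst hA _ fun j => ?_
  cases j with
  | zero => exact hU
  | succ j => exact .var j

theorem ctx (hA : ∀ i, (A i).Closed) (C : Ctx) : Fill A fun i => C.fill (A i) := by
  induction C with
  | hole => exact .hole
  | lam j C ih => exact .lam (ih.rename hA _)
  | appL C M ih => exact .app ih (const A M)
  | appR M C ih => exact .app (const A M) ih
  | choiceL C M ih => exact .choice ih (const A M)
  | choiceR M C ih => exact .choice (const A M) ih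

/-- To bound the convergence of multi-hole contexts filled with `A k` by a weighted average of their
convergence when filled with `A i`, it suffices to consider those with a hole in head position. -/
theorem headProbAt_le_sum [Fintype ι] (hA : ∀ i, (A i).Closed) (k : ι) (w : ι → ℝ≥0∞)
    (hw : ∑ i, w i = 1)
    (hole : ∀ n, (∀ T S, Fill A T → FillStack A S →
        headProbAt n (T k) (S k) ≤ ∑ i, w i * headProb (T i) (S i)) →
      ∀ S, FillStack A S → headProbAt (n + 1) (A k) (S k) ≤ ∑ i, w i * headProb (A i) (S i)) :
    ∀ n T S, Fill A T → FillStack A S →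
      headProbAt n (T k) (S k) ≤ ∑ i, w i * headProb (T i) (S i) := by
  intro n
  induction n with
  | zero => exact fun _ _ _ _ => zero_le
  | succ n ih =>
    intro T S hT hS
    cases hT with
    | hole => exact hole n ih S hS
    -- Every filling has already converged; the average is 1 because the weights sum to 1.
    | var j => simp [headProb_var, hw, headProbAt]
    | lam hT =>
      cases hS with
      | nil => simpa only [headProbAt, headProb_lam_nil] using ih _ _ hT .nil
      | cons hU hS => simpa only [headProbAt, headProb_lam_cons] using ih _ _ (hT.inst hA hU) hS
    | app hT hU => simpa only [headProbAt, headProb_app] using ih _ _ hT (.cons hU hS)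
    | choice hT hU =>
      simp only [headProb_choice, mul_add, Finset.sum_add_distrib, mul_left_comm _ (2⁻¹ : ℝ≥0∞),
        ← Finset.mul_sum]
      exact add_le_add (mul_le_mul_right (ih _ _ hT hS) _) (mul_le_mul_right (ih _ _ hU hS) _)

theorem headProb_le_sum [Fintype ι] (hA : ∀ i, (A i).Closed) (k : ι) (w : ι → ℝ≥0∞)
    (hw : ∑ i, w i = 1)
    (hole : ∀ n, (∀ T S, Fill A T → FillStack A S →
        headProbAt n (T k) (S k) ≤ ∑ i, w i * headProb (T i) (S i)) →
      ∀ S, FillStack A S → headProbAt (n + 1) (A k) (S k) ≤ ∑ i, w i * headProb (A i) (S i))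
    {T : ι → Term} {S : ι → List Term} (hT : Fill A T) (hS : FillStack A S) :
    headProb (T k) (S k) ≤ ∑ i, w i * headProb (T i) (S i) :=
  iSup_le fun n => headProbAt_le_sum hA k w hw hole n T S hT hS

end Fill

namespace FillStack

variable {A : ι → Term}

theorem const (A : ι → Term) (S : List Term) : FillStack A fun _ => S := by
  induction S with
  | nil => exact .nil
  | cons N S ih => exact .cons (.const A N) ih

/-- Allows some of the fillings to be forgotten, so that a result on the pair `Ω`, `I` applies to
the triple that also contains `Ω ⊕ I`. -/
theorem reindex {κ : Type*} (f : κ → ι) {S : ι → List Term} (hS : FillStack A S) :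
    FillStack (A ∘ f) (S ∘ f) := by
  have key : ∀ T, Fill A T → Fill (A ∘ f) (T ∘ f) := fun T hT => by
    induction hT with
    | hole => exact .hole
    | var j => exact .var j
    | lam hT ih => exact .lam ih
    | app hT hU ihT ihU => exact .app ihT ihU
    | choice hT hU ihT ihU => exact .choice ihT ihU
  induction hS with
  | nil => exact .nil
  | cons hT hS ih => exact .cons (key _ hT) ih

end FillStack

end Fill

/-! ### Contexts filled with `Ω`, `I` and `Ω ⊕ I` -/

theorem closed_termI : termI.Closed := fun i => by simp [FreeIn, termI]

theorem closed_termOmega : termOmega.Closed := fun i => by simp [FreeIn, termOmega, termDelta]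

/-- `Ω` with any stack returns to itself after two machine steps. -/
theorem headProbAt_termOmega (n : ℕ) (S : List Term) : headProbAt n termOmega S = 0 := by
  induction n using Nat.strong_induction_on with
  | _ n ih =>
    rcases n with _ | _ | n
    · rfl
    · rfl
    · exact ih n (by omega)

theorem headProb_termOmega (S : List Term) : headProb termOmega S = 0 := by
  simp [headProb, headProbAt_termOmega]

/-- A filling with `Ω` loses nothing before a hole reaches head position, and diverges from then on.
-/
theorem headProb_termOmega_le_termI {S : Bool → List Term} {T : Bool → Term}
    (hT : Fill (fun b => bif b then termI else termOmega) T)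
    (hS : FillStack (fun b => bif b then termI else termOmega) S) :
    headProb (T false) (S false) ≤ headProb (T true) (S true) := by
  refine (Fill.headProb_le_sum (fun b => ?_) false (fun b => bif b then 1 else 0) (by simp) ?_
    hT hS).trans_eq (by simp)
  · cases b
    exacts [closed_termOmega, closed_termI]
  · exact fun n _ S _ => (headProbAt_termOmega _ _).trans_le zero_le

/-- The terms `Ω ⊕ I`, `Ω` and `I`. -/
def choiceFamily : Fin 3 → Term := ![choice termOmega termI, termOmega, termI]

theorem headProb_choiceFamily_le {S : Fin 3 → List Term} {T : Fin 3 → Term}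
    (hT : Fill choiceFamily T) (hS : FillStack choiceFamily S) :
    headProb (T 0) (S 0) ≤ 2⁻¹ * headProb (T 1) (S 1) + 2⁻¹ * headProb (T 2) (S 2) := by
  refine (Fill.headProb_le_sum (fun i => ?_) 0 ![0, 2⁻¹, 2⁻¹] ?_ ?_ hT hS).trans_eq ?_
  · fin_cases i
    exacts [fun i h => h.elim (closed_termOmega i) (closed_termI i), closed_termOmega, closed_termI]
  · simp [Fin.sum_univ_three, ENNReal.inv_two_add_inv_two]
  · intro n ih S hS
    -- Once the choice at the head falls on `I`, the stack still contains unresolved copies of `Ω ⊕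
    -- I`; the induction hypothesis resolves these all at once.
    have h1 := ih _ _ (Fill.const _ termI) hS
    simp only [Fin.sum_univ_three, choiceFamily, Matrix.cons_val, zero_mul, zero_add,
      headProb_termOmega, mul_zero, headProbAt, headProbAt_termOmega] at h1 ⊢
    refine mul_le_mul_right (h1.trans ?_) _
    have hS' : FillStack (fun b => bif b then termI else termOmega)
        (S ∘ fun b : Bool => bif b then 2 else 1) := by
      convert hS.reindex fun b : Bool => bif b then 2 else 1 using 1
      funext b
      cases b <;> rfl
    -- Replacing the remaining `Ω` by `I` bounds the average by the filling with `I` alone. Its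
    -- factor 1/2 is all that the right-hand side offers, as the `Ω` branch contributes 0.
    have h2 := headProb_termOmega_le_termI (Fill.const _ termI) hS'
    calc _ ≤ 2⁻¹ * headProb termI (S 2) + 2⁻¹ * headProb termI (S 2) :=
          add_le_add (mul_le_mul_right h2 _) le_rfl
      _ = _ := by rw [← add_mul, ENNReal.inv_two_add_inv_two, one_mul]
  · simp [Fin.sum_univ_three]

/-- Without an argument at the head, the filling with `N` converges with probability 1. With an
argument, `M` is first replaced by `N` in the argument and in the rest of the stack, and only then
is the choice moved outwards. -/
theorem ctxLE_witness : CtxLE witnessM.1 witnessN.1 := by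
  intro C
  have hA : ∀ b : Bool, (bif b then witnessN.1 else witnessM.1).Closed := fun b => by
    cases b
    exacts [witnessM.2, witnessN.2]
  rw [mass_eval, mass_eval]
  refine (Fill.headProb_le_sum hA false (fun b => bif b then 1 else 0) (by simp) ?_
    (Fill.ctx hA C) .nil).trans_eq (by simp)
  intro n ih S hS
  cases hS with
  | nil =>
    refine (headProbAt_le_one _ _ _).trans ?_
    simp [witnessN, headProb_lam_nil, headProb_choice, headProb_app, headProb_var,
      ENNReal.inv_two_add_inv_two]
  | @cons P S hP hS =>
    have h1 := ih _ _ (.app hP (.const _ (choice termOmega termI))) hS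
    -- Here the single hole is the argument of `P`; `P` and the stack, already filled with `N`, are
    -- constant.
    have h2 := headProb_choiceFamily_le (.app (.const _ (P true)) .hole) (.const _ (S true))
    simp only [Fintype.sum_bool, cond_true, cond_false, one_mul, zero_mul, add_zero] at h1 ⊢
    have hO := closed_termOmega.subst_eq (instSub (P true))
    have hI := closed_termI.subst_eq (instSub (P true))
    have hO' := closed_termOmega.subst_eq (instSub (P false))
    have hI' := closed_termI.subst_eq (instSub (P false))
    refine le_trans ?_ ((h1.trans h2).trans_eq ?_)
    · simp only [witnessM, headProbAt, inst, Term.subst, instSub, hO', hI']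
      exact le_rfl
    · simp only [witnessN, headProb_lam_cons, inst, Term.subst, instSub, hO, hI, headProb_choice]
      rfl


/-! ### Consequences of simulation -/

namespace LabelledMarkovChain

variable {S : Type*} [Countable S] {L : Type*} {𝓜 : LabelledMarkovChain S L}

theorem prob_le_probSet {s t : S} {l : L} {X : Set S} (h : t ∈ X) :
    𝓜.prob s l t ≤ 𝓜.probSet s l X :=
  ENNReal.le_tsum (f := fun t : X => 𝓜.prob s l t) ⟨t, h⟩

theorem probSet_add_prob_le_one {s t : S} {l : L} {X : Set S} (h : t ∉ X) :
    𝓜.probSet s l X + 𝓜.prob s l t ≤ 1 := by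
  classical
  refine le_trans ?_ (𝓜.sum_le_one s l)
  rw [probSet, tsum_subtype, ← tsum_ite_eq t fun t => 𝓜.prob s l t, ← ENNReal.tsum_add]
  refine ENNReal.tsum_le_tsum fun u => ?_
  by_cases hu : u = t
  · subst hu; simp [h]
  · by_cases hX : u ∈ X <;> simp [hu, hX]

theorem IsSimulation.le_probSet {R : S → S → Prop} (hR : 𝓜.IsSimulation R) {s t : S} (h : R s t)
    (l : L) (u : S) : 𝓜.prob s l u ≤ 𝓜.probSet t l {v | R u v} := by
  refine (prob_le_probSet (Set.mem_singleton u)).trans ((hR.sim s t h {u} l).trans_eq ?_)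
  simp

/-- If `s` is simulated by `t`, then a transition from `s` to `u` of probability `p` is simulated by
every transition from `t` to `v` whose probability is more than `1 - p`. -/
theorem IsSimulation.rel_of_one_lt {R : S → S → Prop} (hR : 𝓜.IsSimulation R) {s t : S}
    (h : R s t) {l : L} {u v : S} (huv : 1 < 𝓜.prob s l u + 𝓜.prob t l v) : R u v := by
  by_contra hn
  refine huv.not_ge (le_trans ?_ (probSet_add_prob_le_one (𝓜 := 𝓜) (s := t) (l := l)
    (X := {v | R u v}) hn))
  exact add_le_add (hR.le_probSet h l u) le_rfl

end LabelledMarkovChain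

theorem closed_inst {H L : Term} (hH : (lam H).Closed) (hL : L.Closed) : (inst H L).Closed := by
  have key : ∀ (M : Term) (σ : ℕ → Term) (i : ℕ), FreeIn i (subst σ M) →
      ∃ j, FreeIn j M ∧ FreeIn i (σ j) := by
    intro M
    induction M with
    | var j => exact fun σ i h => ⟨j, rfl, h⟩
    | lam M ih =>
      intro σ i h
      obtain ⟨j, hj, h'⟩ := ih _ _ h
      cases j with
      | zero => exact absurd (show i + 1 = 0 from h') (by omega)
      | succ j =>
        obtain ⟨k, hk, hki⟩ := freeIn_rename (show FreeIn (i + 1) (rename Nat.succ (σ j)) from h')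
        exact ⟨j, hj, by rwa [← Nat.succ_injective hki]⟩
    | app M N ihM ihN =>
      rintro σ i (h | h)
      · obtain ⟨j, hj, h'⟩ := ihM _ _ h; exact ⟨j, .inl hj, h'⟩
      · obtain ⟨j, hj, h'⟩ := ihN _ _ h; exact ⟨j, .inr hj, h'⟩
    | choice M N ihM ihN =>
      rintro σ i (h | h)
      · obtain ⟨j, hj, h'⟩ := ihM _ _ h; exact ⟨j, .inl hj, h'⟩
      · obtain ⟨j, hj, h'⟩ := ihN _ _ h; exact ⟨j, .inr hj, h'⟩
  intro i hi
  obtain ⟨j, hj, h⟩ := key _ _ _ hi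
  cases j with
  | zero => exact hL i h
  | succ j => exact hH j hj

/-- Similar distinguished head normal forms yield similar terms under application. -/
theorem LabelledMarkovChain.IsSimulation.rel_inst
    {R : ClosedTerm ⊕ DistHNF → ClosedTerm ⊕ DistHNF → Prop}
    (hR : termChain.IsSimulation R) {H K : DistHNF} (h : R (.inr H) (.inr K)) (L : ClosedTerm) :
    R (.inl ⟨Term.inst H.1 L.1, closed_inst H.2.2 L.2⟩)
      (.inl ⟨Term.inst K.1 L.1, closed_inst K.2.2 L.2⟩) := by
  refine hR.rel_of_one_lt h (l := some L) ?_
  simp only [termChain, transProb, if_true]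
  exact ENNReal.lt_add_right (by simp) (by simp)

theorem LabelledMarkovChain.IsSimulation.eval_lam_le
    {R : ClosedTerm ⊕ DistHNF → ClosedTerm ⊕ DistHNF → Prop}
    (hR : termChain.IsSimulation R) {M N : ClosedTerm} (h : R (.inl M) (.inl N)) (H : DistHNF) :
    eval M.1 (lam H.1) ≤ headProb N.1 [] := by
  refine (hR.le_probSet h none (.inr H)).trans ?_
  refine (ENNReal.tsum_comp_le_tsum_of_injective Subtype.val_injective _).trans ?_
  rw [ENNReal.summable.tsum_sum ENNReal.summable, ← mass_eval]
  simp only [termChain, transProb, tsum_zero, zero_add]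
  have hinj : Function.Injective (fun H : DistHNF => Term.lam H.1) := fun a b h =>
    Subtype.ext (Term.lam.inj h)
  exact ENNReal.tsum_comp_le_tsum_of_injective hinj _

/-! ### Separation of the two terms by applicative similarity -/

/-- The distinguished head normal form `νx. x P`. -/
def distVarApp (P : Term) (hP : P.Closed) : DistHNF :=
  ⟨app (var 0) P, .lam (.neutral (.app (.var 0) P)), fun i h =>
    h.elim (fun h => absurd (show i + 1 = 0 from h) (by omega)) (hP _)⟩

/-- The distinguished head normal form `νx. x`. -/
def distI : DistHNF := ⟨var 0, .lam (.neutral (.var 0)), closed_termI⟩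

theorem exists_bigStep_var_app (i : ℕ) (P : Term) :
    ∃ D, BigStep (app (var i) P) D ∧ 1 ≤ D (app (var i) P) := by
  classical
  -- The distribution on a variable has no abstraction in its support, so the choice of `E` is
  -- immaterial.
  refine ⟨_, .app (.var i) (E := fun _ => .bot) fun H _ => .bot _, ?_⟩
  change 1 ≤ HeadDist.appFun (HeadDist.var i) (fun _ => HeadDist.bot) P _
  refine le_add_left (le_trans ?_ (ENNReal.le_tsum (Term.var i)))
  simp [IsNeutral.var, HeadDist.var]

theorem one_le_eval_lam_var_app (P : Term) :
    1 ≤ eval (lam (app (var 0) P)) (lam (app (var 0) P)) := by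
  obtain ⟨D, hD, h⟩ := exists_bigStep_var_app 0 P
  exact h.trans (hD.lam.le_eval (lam (app (var 0) P)))

theorem half_le_eval_lam_choice (P Q : Term) :
    2⁻¹ ≤ eval (lam (choice (app (var 0) P) (app (var 0) Q))) (lam (app (var 0) P)) ∧
      2⁻¹ ≤ eval (lam (choice (app (var 0) P) (app (var 0) Q))) (lam (app (var 0) Q)) := by
  obtain ⟨D, hD, h⟩ := exists_bigStep_var_app 0 P
  obtain ⟨E, hE, h'⟩ := exists_bigStep_var_app 0 Q
  have key := (BigStep.choice hD hE).lam.le_eval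
  constructor
  · refine le_trans (le_add_right ?_) (key (lam (app (var 0) P)))
    simpa using mul_le_mul_right h (2⁻¹ : ℝ≥0∞)
  · refine le_trans (le_add_left ?_) (key (lam (app (var 0) Q)))
    simpa using mul_le_mul_right h' (2⁻¹ : ℝ≥0∞)

theorem BigStep.termI : BigStep termI (HeadDist.lam (.var 0)) := .lam (.var 0)

/-- The only abstraction in the support for `I` has body `x`, and `x[P/x] = P`, so `I P` inherits
every approximation of `P`. -/
theorem BigStep.le_eval_termI_app {P : Term} {D : HeadDist} (h : BigStep P D) (K : Term) :
    D K ≤ eval (Term.app _root_.termI P) K := by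
  classical
  refine le_trans ?_ ((BigStep.termI.app (N := P) (E := fun _ => D) fun H hH => ?_).le_eval K)
  · refine le_add_right (le_trans ?_ (ENNReal.le_tsum (Term.var 0)))
    simp [HeadDist.lam, HeadDist.lamFun, HeadDist.var]
  · have : H = Term.var 0 := by
      by_contra hn
      exact hH (if_neg hn)
    subst this
    exact h

theorem one_le_lam_var_self : 1 ≤ HeadDist.lam (.var 0) termI := by
  classical
  simp [HeadDist.lam, HeadDist.lamFun, HeadDist.var, termI]

theorem headProb_termI_app (P : Term) : headProb (app termI P) [] = headProb P [] := by
  rw [headProb_app, termI, headProb_lam_cons]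
  rfl

theorem headProb_termI_app_choice :
    headProb (app termI (choice termOmega termI)) [] = 2⁻¹ := by
  rw [headProb_termI_app, headProb_choice, headProb_termOmega, mul_zero, zero_add, termI,
    headProb_lam_nil, headProb_var, mul_one]

theorem closed_choice_termOmega_termI : (choice termOmega termI).Closed :=
  fun i h => h.elim (closed_termOmega i) (closed_termI i)

theorem one_lt_one_add_half : (1 : ℝ≥0∞) < 1 + 2⁻¹ :=
  ENNReal.lt_add_right (by simp) (by simp)

/-- Distinguished head normal forms `νx. x P` and `νx. x Q` are dissimilar if the evaluation of
`P` yields `I` with a probability that exceeds the probability that `Q` converges. -/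
theorem not_rel_distVarApp {R : ClosedTerm ⊕ DistHNF → ClosedTerm ⊕ DistHNF → Prop}
    (hR : termChain.IsSimulation R) {P Q : Term} (hP : P.Closed) (hQ : Q.Closed) {D : HeadDist}
    (hD : BigStep P D) (h : headProb Q [] < D termI) :
    ¬ R (.inr (distVarApp P hP)) (.inr (distVarApp Q hQ)) := by
  intro hr
  have h1 := hR.rel_inst hr ⟨termI, closed_termI⟩
  have h2 := hR.eval_lam_le h1 distI
  have e : ∀ (X : Term) (hX : X.Closed),
      Term.inst (distVarApp X hX).1 termI = app termI X := fun X hX => by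
    simp only [distVarApp, Term.inst, Term.subst, instSub, hX.subst_eq]
  simp only [e, headProb_termI_app] at h2
  exact h.not_ge ((hD.le_eval_termI_app termI).trans h2)

theorem not_PAS_witnessM_witnessN : ¬ PAS witnessM witnessN := by
  rintro ⟨R, hR, h⟩
  refine not_rel_distVarApp hR closed_choice_termOmega_termI closed_termOmega
    -- Approximating `Ω` by `⊥` suffices: the resulting distribution gives `I` the weight 1/2,
    -- against convergence probability 0 for `Ω`.
    (.choice (.bot termOmega) BigStep.termI) ?_ (hR.rel_of_one_lt h (l := none) ?_)
  · rw [headProb_termOmega]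
    refine lt_of_lt_of_le (b := 2⁻¹) (by simp) (le_add_left ?_)
    simpa using mul_le_mul_right one_le_lam_var_self (2⁻¹ : ℝ≥0∞)
  · exact one_lt_one_add_half.trans_le (add_le_add (one_le_eval_lam_var_app _)
      (half_le_eval_lam_choice termOmega termI).1)

theorem not_PAS_witnessN_witnessM : ¬ PAS witnessN witnessM := by
  rintro ⟨R, hR, h⟩
  refine not_rel_distVarApp hR closed_termI closed_choice_termOmega_termI BigStep.termI ?_
    (hR.rel_of_one_lt h (l := none) ?_)
  · rw [← headProb_termI_app, headProb_termI_app_choice]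
    exact lt_of_lt_of_le (by simp) one_le_lam_var_self
  · refine (one_lt_one_add_half.trans_eq (add_comm _ _)).trans_le (add_le_add ?_ ?_)
    · exact (half_le_eval_lam_choice termOmega termI).2
    · exact one_le_eval_lam_var_app _

theorem mainTheorem5 :
    (¬ PAS witnessM witnessN ∧ ¬ PAS witnessN witnessM ∧ CtxLE witnessM.1 witnessN.1) ∧
    (¬ ∀ P Q : Term, CtxLE P Q → OpenPAS P Q) ∧
    (¬ ∀ P Q : Term, OpenPAS P Q ↔ CtxLE P Q) := by
  have key : ¬ OpenPAS witnessM.1 witnessN.1 := fun h => not_PAS_witnessM_witnessN <|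
    -- Both terms are closed, so the empty list of variables is admissible and no abstraction is
    -- added.
    h [] (fun i hi => absurd hi (witnessM.2 i)) (fun i hi => absurd hi (witnessN.2 i)) .nil
  exact ⟨⟨not_PAS_witnessM_witnessN, not_PAS_witnessN_witnessM, ctxLE_witness⟩,
    fun h => key (h _ _ ctxLE_witness), fun h => key ((h _ _).2 ctxLE_witness)⟩
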